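/- A locale $X$ is given by its frame of opens $\mathcal{O}(X)$, and a continuous map $f : X \to Y$ by a frame homomorphism $f^* : \mathcal{O}(Y) \to \mathcal{O}(X)$ with right adjoint $f_*$. An open $U$ is compact if every directed family whose join is above $U$ has a member above $U$, and clopen if it has a complement. A basis is a small family of opens such that every open is a join of members of the family. A locale is spectral if it has a basis of compact opens that contains $\top$ and is closed under binary meets, zero-dimensional if it has a basis of clopens, and Stone if it is zero-dimensional and $\top$ is compact. A continuous map $f$ is spectral if $f^*$ preserves compact opens, and perfect if $f_*$ preserves directed joins. The category $\mathbf{Spec}$ consists of the spectral locales and spectral maps, the category $\mathbf{Stone}$ of the Stone locales and all continuous maps; Stone locales are spectral and continuous maps between them are spectral, so there is an inclusion $\mathbf{Stone} \hookrightarrow \mathbf{Spec}$. For a locale $A$, let $\mathsf{Patch}(A)$ be the locale whose frame of opens is the set of nuclei on $\mathcal{O}(A)$ (inflationary, idempotent maps $\mathcal{O}(A) \to \mathcal{O}(A)$ preserving binary meets) that preserve directed joins, ordered pointwise. Let $\varepsilon_A : \mathsf{Patch}(A) \to A$ be the continuous map whose inverse image sends an open $U$ to the closed nucleus $V \mapsto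 U \vee V$. **Theorem.** 1. If $A$ is a spectral locale, then $\mathsf{Patch}(A)$ is a Stone locale. 2. A continuous map between spectral locales is perfect if and only if it is spectral. 3. If $A$ is a spectral locale, then $\varepsilon_A$ is perfect. 4. If $X$ is a Stone locale, $A$ a spectral locale and $f : X \to A$ a spectral map, then there is a unique spectral map $\bar f : X \to \mathsf{Patch}(A)$ with $\varepsilon_A \circ \bar f = f$. 5. The inclusion $\mathbf{Stone} \hookrightarrow \mathbf{Spec}$ is full and faithful and has a right adjoint which sends each spectral locale $A$ to $\mathsf{Patch}(A)$ and whose counit at $A$ is $\varepsilon_A$. That is, $\mathbf{Stone}$ is a coreflective subcategory of $\mathbf{Spec}$. -/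

import Mathlib

open CategoryTheory

universe w v

/-! ### Bases, spectral and Stone frames -/

section Frames

variable {L : Type v} [Order.Frame L]

/-- A family `B` of opens is a basis if every open is the join of a subfamily of `B`. -/
def IsLocaleBasis {I : Type w} (B : I → L) : Prop :=
  ∀ U : L, ∃ J : Set I, U = ⨆ i ∈ J, B i

variable (L) in
/-- A spectral locale (given by its frame of opens `L`): there is a small (indexed by a type in the
universe `w`) basis of compact opens which is closed under finite meets. -/
def IsSpectralFrame : Prop :=
  ∃ (I : Type w) (B : I → L), IsLocaleBasis B ∧ (∀ i, IsCompactElement (B i)) ∧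
    (∃ t, B t = ⊤) ∧ ∀ i j, ∃ k, B k = B i ⊓ B j

/-- `U` is well inside `V`. -/
def IsWellInside (U V : L) : Prop :=
  ∃ W : L, U ⊓ W = ⊥ ∧ V ⊔ W = ⊤

/-- An open is clopen if it is well inside itself. -/
def IsClopenElement (U : L) : Prop := IsWellInside U U

variable (L) in
/-- A zero-dimensional locale: there is a small basis of clopens. -/
def IsZeroDimensionalFrame : Prop :=
  ∃ (I : Type w) (B : I → L), IsLocaleBasis B ∧ ∀ i, IsClopenElement (B i)

variable (L) in
/-- A Stone locale: compact and zero-dimensional. -/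
def IsStoneFrame : Prop :=
  IsCompactElement (⊤ : L) ∧ IsZeroDimensionalFrame.{w} L

/-! Clopens and compact opens coincide in a Stone locale; Stone locales are spectral. -/

lemma isClopenElement_iff {U : L} : IsClopenElement U ↔ IsComplemented U := by
  constructor
  · rintro ⟨W, h₁, h₂⟩
    exact ⟨W, disjoint_iff.2 h₁, codisjoint_iff.2 h₂⟩
  · rintro ⟨W, h₁, h₂⟩
    exact ⟨W, disjoint_iff.1 h₁, codisjoint_iff.1 h₂⟩

lemma IsClopenElement.isCompactElement (hL : IsCompactElement (⊤ : L)) {U : L}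
    (hU : IsClopenElement U) : IsCompactElement U := by
  obtain ⟨W, h₁, h₂⟩ := hU
  rw [CompleteLattice.isCompactElement_iff_le_of_directed_sSup_le] at hL ⊢
  intro s hs hd hle
  obtain ⟨_, ⟨x, hx, rfl⟩, hx'⟩ := hL ((fun x => x ⊔ W) '' s) (hs.image _)
    (by
      rintro _ ⟨x, hx, rfl⟩ _ ⟨y, hy, rfl⟩
      obtain ⟨z, hz, hxz, hyz⟩ := hd x hx y hy
      exact ⟨z ⊔ W, ⟨z, hz, rfl⟩, sup_le_sup_right hxz _, sup_le_sup_right hyz _⟩)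
    (by
      rw [← h₂]
      refine sup_le (hle.trans (sSup_le fun x hx => ?_)) ?_
      · exact le_sup_left.trans (le_sSup ⟨x, hx, rfl⟩)
      · obtain ⟨x, hx⟩ := hs
        exact le_sup_right.trans (le_sSup ⟨x, hx, rfl⟩))
  refine ⟨x, hx, ?_⟩
  have hxW : x ⊔ W = ⊤ := top_le_iff.1 hx'
  calc U = U ⊓ (x ⊔ W) := by rw [hxW, inf_top_eq]
    _ = U ⊓ x := by rw [inf_sup_left, h₁, sup_bot_eq]
    _ ≤ x := inf_le_right

lemma IsCompactElement.isClopenElement (hL : IsZeroDimensionalFrame.{w} L) {U : L}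
    (hU : IsCompactElement U) : IsClopenElement U := by
  classical
  obtain ⟨I, B, hB, hc⟩ := hL
  obtain ⟨J, hJ⟩ := hB U
  rw [iSup_subtype'] at hJ
  obtain ⟨t, ht⟩ := CompleteLattice.IsCompactElement.exists_finset_of_le_iSup L hU (fun i : J => B i) hJ.le
  have hle : U = ⨆ i ∈ t, B i :=
    le_antisymm ht (hJ ▸ iSup₂_le fun i _ => le_iSup (fun i : J => B i) i)
  rw [hle, ← Finset.sup_eq_iSup, isClopenElement_iff]
  exact Finset.sup_induction isComplemented_bot (fun _ h _ h' => h.sup h')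
    fun i _ => isClopenElement_iff.1 (hc i)

lemma IsStoneFrame.isSpectralFrame (hL : IsStoneFrame.{w} L) : IsSpectralFrame.{w} L := by
  obtain ⟨hcpt, I, B, hB, hc⟩ := hL
  have key : ∀ l : List I, IsComplemented ((l.map B).foldr (· ⊓ ·) ⊤) := by
    intro l
    induction l with
    | nil => exact isComplemented_top
    | cons a l ih => exact (isClopenElement_iff.1 (hc a)).inf ih
  refine ⟨List I, fun l => (l.map B).foldr (· ⊓ ·) ⊤, fun U => ?_,
    fun l => (isClopenElement_iff.2 (key l)).isCompactElement hcpt, ⟨[], rfl⟩,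
    fun l m => ⟨l ++ m, ?_⟩⟩
  · obtain ⟨J, hJ⟩ := hB U
    refine ⟨(fun i => [i]) '' J, ?_⟩
    rw [iSup_image, hJ]
    simp
  · induction l with
    | nil => simp
    | cons a l ih => simpa [inf_assoc] using congrArg (B a ⊓ ·) ih

lemma IsClopenElement.map {M : Type v} [Order.Frame M] (h : FrameHom L M) {U : L}
    (hU : IsClopenElement U) : IsClopenElement (h U) := by
  obtain ⟨W, h₁, h₂⟩ := hU
  exact ⟨h W, by rw [← map_inf, h₁, map_bot], by rw [← map_sup, h₂, map_top]⟩

end Frames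

/-! ### The frame of Scott continuous nuclei -/

/-- The frame of opens of the patch locale: the Scott continuous nuclei, ordered pointwise. -/
def PatchFrame (L : Type v) [Order.Frame L] : Type v :=
  {j : Nucleus L // ScottContinuous j}

namespace PatchFrame

variable {L : Type v} [Order.Frame L]

lemma scottContinuous_iff (j : Nucleus L) :
    ScottContinuous j ↔
      ∀ d : Set L, d.Nonempty → DirectedOn (· ≤ ·) d → (∀ x ∈ d, j x = x) → j (sSup d) = sSup d := by
  constructor
  · intro h d hn hd hx
    have := (h hn hd (isLUB_sSup d)).sSup_eq
    rw [← this, Set.image_congr hx, Set.image_id']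
  · intro h d hn hd a ha
    obtain rfl := ha.sSup_eq
    have hfix := h (j '' d) (hn.image _)
      (by
        rintro _ ⟨x, hx, rfl⟩ _ ⟨y, hy, rfl⟩
        obtain ⟨z, hz, hxz, hyz⟩ := hd x hx y hy
        exact ⟨j z, ⟨z, hz, rfl⟩, j.monotone hxz, j.monotone hyz⟩)
      (by rintro _ ⟨x, _, rfl⟩; exact j.idempotent x)
    have : j (sSup d) = sSup (j '' d) := by
      refine le_antisymm ?_ (sSup_le ?_)
      · rw [← hfix]
        exact j.monotone (sSup_le fun x hx => Nucleus.le_apply.trans (le_sSup ⟨x, hx, rfl⟩))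
      · rintro _ ⟨x, hx, rfl⟩
        exact j.monotone (le_sSup hx)
    rw [this]
    exact isLUB_sSup _

/-- An open is fixed by a join of nuclei if and only if it is fixed by all of them. -/
lemma sSup_apply_eq_iff (K : Set (Nucleus L)) (a : L) :
    sSup K a = a ↔ ∀ k ∈ K, k a = a := by
  constructor
  · intro h k hk
    exact le_antisymm ((Nucleus.coe_le_coe.2 (le_sSup hk) a).trans h.le) Nucleus.le_apply
  · intro h
    let S : Sublocale L :=
      { carrier := {x | ∀ k ∈ K, k x = x}
        sInf_mem' := fun s hs k hk =>
          le_antisymm (le_sInf fun x hx => (k.monotone (sInf_le hx)).trans (hs hx k hk).le)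
            Nucleus.le_apply
        himp_mem' := fun x y hy k hk => by
          have := k.map_himp_apply x y
          rwa [hy k hk] at this }
    have hS : ∀ x, S.toNucleus x ∈ S := fun x => (S.restrict x).2
    have hle : sSup K ≤ S.toNucleus := sSup_le fun k hk x => by
      have := k.monotone (Nucleus.le_apply (n := S.toNucleus) (x := x))
      exact this.trans (hS x k hk).le
    have ha : S.toNucleus a = a := by
      rw [Sublocale.toNucleus_apply, Sublocale.restrict_of_mem (S := S) h]
    exact le_antisymm ((Nucleus.coe_le_coe.2 hle a).trans ha.le) Nucleus.le_apply

lemma scottContinuous_sSup {K : Set (Nucleus L)} (hK : ∀ k ∈ K, ScottContinuous k) :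
    ScottContinuous (sSup K : Nucleus L) := by
  rw [scottContinuous_iff]
  intro d hn hd hx
  rw [sSup_apply_eq_iff]
  intro k hk
  exact (scottContinuous_iff k).1 (hK k hk) d hn hd fun x hxd =>
    (sSup_apply_eq_iff K x).1 (hx x hxd) k hk

lemma scottContinuous_inf {j k : Nucleus L} (hj : ScottContinuous j) (hk : ScottContinuous k) :
    ScottContinuous (j ⊓ k : Nucleus L) := by
  intro d hn hd a ha
  obtain rfl := ha.sSup_eq
  have hj' := (hj hn hd ha).sSup_eq
  have hk' := (hk hn hd ha).sSup_eq
  refine ⟨?_, fun b hb => ?_⟩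
  · rintro _ ⟨x, hx, rfl⟩
    exact (j ⊓ k).monotone (le_sSup hx)
  · rw [Nucleus.inf_apply, ← hj', ← hk', sSup_inf_sSup]
    refine iSup₂_le ?_
    rintro ⟨_, _⟩ ⟨⟨x, hx, rfl⟩, ⟨y, hy, rfl⟩⟩
    obtain ⟨z, hz, hxz, hyz⟩ := hd x hx y hy
    exact (inf_le_inf (j.monotone hxz) (k.monotone hyz)).trans (hb ⟨z, hz, rfl⟩)

lemma scottContinuous_top : ScottContinuous (⊤ : Nucleus L) :=
  (scottContinuous_iff _).2 fun _ ⟨x, hx⟩ _ h =>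
    have h' : (⊤ : L) = x := h x hx
    le_antisymm (h'.le.trans (le_sSup hx)) le_top

instance : PartialOrder (PatchFrame L) :=
  inferInstanceAs (PartialOrder {j : Nucleus L // ScottContinuous j})

instance : SupSet (PatchFrame L) where
  sSup K := ⟨sSup (Subtype.val '' K), scottContinuous_sSup (by rintro _ ⟨k, _, rfl⟩; exact k.2)⟩

lemma isLUB_sSup (K : Set (PatchFrame L)) : IsLUB K (sSup K) :=
  ⟨fun k hk => le_sSup (α := Nucleus L) ⟨k, hk, rfl⟩,
    fun j hj => sSup_le (α := Nucleus L) (by rintro _ ⟨k, hk, rfl⟩; exact hj hk)⟩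

instance : CompleteLattice (PatchFrame L) where
  __ := completeLatticeOfSup (PatchFrame L) isLUB_sSup
  inf j k := ⟨j.1 ⊓ k.1, scottContinuous_inf j.2 k.2⟩
  inf_le_left j k := inf_le_left (α := Nucleus L) (a := j.1) (b := k.1)
  inf_le_right j k := inf_le_right (a := j.1) (b := k.1)
  le_inf i j k (h₁ : i.1 ≤ j.1) (h₂ : i.1 ≤ k.1) := (_root_.le_inf h₁ h₂ : i.1 ≤ j.1 ⊓ k.1)
  top := ⟨⊤, scottContinuous_top⟩
  le_top j := le_top (a := j.1)

instance : Order.Frame (PatchFrame L) := .ofMinimalAxioms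
  { inf_sSup_le_iSup_inf := fun j K => by
      have h : j.1 ⊓ sSup (Subtype.val '' K) ≤ (⨆ k ∈ K, j ⊓ k : PatchFrame L).1 := by
        rw [inf_sSup_eq]
        refine iSup₂_le ?_
        rintro _ ⟨k, hk, rfl⟩
        exact le_iSup₂ (f := fun (k : PatchFrame L) (_ : k ∈ K) => j ⊓ k) k hk
      exact h }

/-- The closed nucleus `V ↦ U ⊔ V`. -/
def closedNucleus (U : L) : Nucleus L where
  toFun V := U ⊔ V
  map_inf' _ _ := sup_inf_left _ _ _
  idempotent' _ := by simp
  le_apply' _ := le_sup_right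

/-- The closed nucleus as an open of the patch locale. -/
def closed (U : L) : PatchFrame L :=
  ⟨closedNucleus U, (scottContinuous_iff _).2 fun _ ⟨x, hx⟩ _ h =>
    sup_eq_right.2 ((sup_eq_right.1 (h x hx)).trans (le_sSup hx))⟩

/-- The frame homomorphism sending an open `U` to the closed nucleus of `U`. -/
def closedHom (L : Type v) [Order.Frame L] : FrameHom L (PatchFrame L) where
  toFun := closed
  map_inf' U V := Subtype.ext <| Nucleus.ext fun _ => sup_inf_right _ _ _
  map_top' := Subtype.ext <| Nucleus.ext fun _ => top_sup_eq _
  map_sSup' S := by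
    refine le_antisymm ?_ (sSup_le ?_)
    · intro V
      refine sup_le (sSup_le fun U hU => ?_) Nucleus.le_apply
      have h : closed U ≤ sSup (closed '' S) := le_sSup ⟨U, hU, rfl⟩
      exact le_sup_left.trans (h V)
    · rintro _ ⟨U, hU, rfl⟩ V
      exact sup_le_sup_right (le_sSup hU) V

end PatchFrame

/-! ### Locales, spectral maps, perfect maps -/

/-- The frame homomorphism `f^* : O(Y) → O(X)` defining a continuous map `f : X ⟶ Y`. -/
def Locale.invImage {X Y : Locale.{v}} (f : X ⟶ Y) : FrameHom Y X :=
  Frm.Hom.hom (Quiver.Hom.unop f)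

/-- The continuous map of locales defined by a frame homomorphism `O(Y) → O(X)`. -/
def Locale.ofInvImage {X Y : Locale.{v}} (h : FrameHom Y X) : X ⟶ Y :=
  Quiver.Hom.op (X := Y.unop) (Y := X.unop) (Frm.ofHom h)

/-- The right adjoint `f_* : O(X) → O(Y)` of `f^*`. -/
noncomputable def Locale.directImage {X Y : Locale.{v}} (f : X ⟶ Y) (U : X) : Y :=
  sSup {V : Y | Locale.invImage f V ≤ U}

/-- A continuous map is spectral if its inverse image preserves compact opens. -/
def Locale.IsSpectralMap {X Y : Locale.{v}} (f : X ⟶ Y) : Prop :=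
  ∀ V : Y, IsCompactElement V → IsCompactElement (Locale.invImage f V)

/-- A continuous map is perfect if the right adjoint of its inverse image is Scott continuous. -/
def Locale.IsPerfectMap {X Y : Locale.{v}} (f : X ⟶ Y) : Prop :=
  ScottContinuous (Locale.directImage f)

/-- The locale `X` is spectral (with a basis indexed by a type in the universe `w`). -/
def Locale.IsSpectral (X : Locale.{v}) : Prop := IsSpectralFrame.{w} X

/-- The locale `X` is Stone (with a basis of clopens indexed by a type in the universe `w`). -/
def Locale.IsStone (X : Locale.{v}) : Prop := IsStoneFrame.{w} X

/-- The patch locale. -/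
def Locale.patch (A : Locale.{v}) : Locale.{v} := Locale.of (PatchFrame A)

/-- The map `ε : Patch(A) ⟶ A` whose inverse image sends `U` to the closed nucleus of `U`. -/
def Locale.patchCounit (A : Locale.{v}) : Locale.patch A ⟶ A :=
  Locale.ofInvImage (X := Locale.patch A) (Y := A) (PatchFrame.closedHom A)

/-! ### The categories of spectral and of Stone locales -/

/-- Spectral locales. -/
structure SpecLocale where
  carrier : Locale.{v}
  isSpectral : Locale.IsSpectral.{w} carrier

/-- Spectral maps. -/
@[ext]
structure SpecLocale.Hom (X Y : SpecLocale.{w, v}) where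
  map : X.carrier ⟶ Y.carrier
  isSpectralMap : Locale.IsSpectralMap map

/-- The category of spectral locales and spectral maps. -/
instance : Category SpecLocale.{w, v} where
  Hom X Y := SpecLocale.Hom X Y
  id X := ⟨𝟙 X.carrier, fun _ h => h⟩
  comp f g := ⟨f.map ≫ g.map, fun V h => f.isSpectralMap _ (g.isSpectralMap V h)⟩

/-- The category of Stone locales and all continuous maps. -/
abbrev StoneLocale : Type (v + 1) :=
  ObjectProperty.FullSubcategory (C := Locale.{v}) Locale.IsStone.{w}

lemma Locale.IsStone.isSpectralMap {X Y : Locale.{v}} (hX : Locale.IsStone.{w} X)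
    (hY : Locale.IsStone.{w} Y) (f : X ⟶ Y) : Locale.IsSpectralMap f :=
  fun _ hV => ((hV.isClopenElement hY.2).map (Locale.invImage f)).isCompactElement hX.1

/-- The inclusion of Stone locales into spectral locales. -/
def stoneToSpec : StoneLocale.{w, v} ⥤ SpecLocale.{w, v} where
  obj X := ⟨X.obj, X.property.isSpectralFrame⟩
  map {X Y} f := ⟨f.hom, X.property.isSpectralMap Y.property f.hom⟩

/-! Over a spectral frame a Scott continuous nucleus `j` is determined by its values at compact
opens `K`. For such `K` the open nucleus `K ⇨ -` is itself Scott continuous, so `closed K` is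
complemented, and `j` is the join of the `closed (j K) ⊓ (closed K)ᶜ`
(`eq_biSup_closed_inf_compl_closed`). Refining this join along a basis gives zero-dimensionality.
Directed joins of Scott continuous nuclei are pointwise. Hence evaluation at `⊥`, which is the
direct image of `ε`, preserves them: `ε` is perfect, and `⊤` is compact in the patch. If `f : X → A`
is spectral and `X` is Stone, each `f^* K` is clopen, so the join formula leaves only `j ↦ ⋁ f^*(j
K) ⊓ (f^* K)ᶜ` as inverse image of the lift. It preserves joins because it has a right adjoint, `W ↦
f_*(f^*(-) ⊔ W)`, whose values are Scott continuous because `f` is perfect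
(`gc_extend_pushforward`). The coreflection is then formal. -/

/-! ### Scott continuity and compact elements -/

section ScottContinuity

variable {L M : Type*} [CompleteLattice L] [CompleteLattice M]

lemma Monotone.scottContinuous {f : L → M} (hf : Monotone f)
    (h : ∀ d : Set L, d.Nonempty → DirectedOn (· ≤ ·) d → f (sSup d) ≤ ⨆ x ∈ d, f x) :
    ScottContinuous f := by
  intro d hn hd a ha
  obtain rfl := ha.sSup_eq
  refine ⟨?_, fun b hb => (h d hn hd).trans (iSup₂_le fun x hx => hb ⟨x, hx, rfl⟩)⟩
  rintro _ ⟨x, hx, rfl⟩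
  exact hf (le_sSup hx)

lemma ScottContinuous.apply_sSup {f : L → M} (hf : ScottContinuous f) {d : Set L}
    (hn : d.Nonempty) (hd : DirectedOn (· ≤ ·) d) : f (sSup d) = ⨆ x ∈ d, f x := by
  rw [← (hf hn hd (isLUB_sSup d)).sSup_eq, sSup_image]

lemma IsCompactElement.exists_le_of_le_biSup {k : M} (hk : IsCompactElement k) {f : L → M}
    (hf : Monotone f) {d : Set L} (hn : d.Nonempty) (hd : DirectedOn (· ≤ ·) d)
    (h : k ≤ ⨆ x ∈ d, f x) : ∃ x ∈ d, k ≤ f x := by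
  rw [← sSup_image] at h
  obtain ⟨_, ⟨x, hx, rfl⟩, hkx⟩ := hk _ _ (hn.image f) (hd.mono_comp (fun _ _ h => hf h))
    (isLUB_sSup _) h
  exact ⟨x, hx, hkx⟩

lemma isCompactElement_sup {a b : L} (ha : IsCompactElement a) (hb : IsCompactElement b) :
    IsCompactElement (a ⊔ b) := by
  intro s u hs hd hu hle
  obtain ⟨x, hx, hax⟩ := ha s u hs hd hu (le_sup_left.trans hle)
  obtain ⟨y, hy, hby⟩ := hb s u hs hd hu (le_sup_right.trans hle)
  obtain ⟨z, hz, hxz, hyz⟩ := hd x hx y hy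
  exact ⟨z, hz, sup_le (hax.trans hxz) (hby.trans hyz)⟩

lemma isCompactElement_bot : IsCompactElement (⊥ : L) :=
  fun _ _ ⟨x, hx⟩ _ _ _ => ⟨x, hx, bot_le⟩

lemma ScottContinuous.le_of_forall_isCompactElement [IsCompactlyGenerated L] {f g : L → M}
    (hf : ScottContinuous f) (hg : Monotone g) (h : ∀ K, IsCompactElement K → f K ≤ g K) (a : L) :
    f a ≤ g a := by
  have hd : DirectedOn (· ≤ ·) {c : L | IsCompactElement c ∧ c ≤ a} := fun x hx y hy =>
    ⟨x ⊔ y, ⟨isCompactElement_sup hx.1 hy.1, sup_le hx.2 hy.2⟩, le_sup_left, le_sup_right⟩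
  conv_lhs => rw [← sSup_compact_le_eq a]
  have hn : {c : L | IsCompactElement c ∧ c ≤ a}.Nonempty := ⟨⊥, isCompactElement_bot, bot_le⟩
  rw [hf.apply_sSup hn hd]
  exact iSup₂_le fun c hc => (h c hc.1).trans (hg hc.2)

end ScottContinuity

/-! ### Compact opens of spectral frames -/

section Spectral

variable {L : Type v} [Order.Frame L]

/-- A compact open need not belong to the basis, but finite sets of indices reach all of them while
staying in the universe `w`. -/
lemma IsLocaleBasis.exists_finset_sup_eq {I : Type w} {B : I → L} (hB : IsLocaleBasis B) {K : L}
    (hK : IsCompactElement K) : ∃ t : Finset I, t.sup B = K := by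
  classical
  obtain ⟨J, hJ⟩ := hB K
  rw [iSup_subtype'] at hJ
  obtain ⟨t, ht⟩ := CompleteLattice.IsCompactElement.exists_finset_of_le_iSup L hK
    (fun i : J => B i) hJ.le
  refine ⟨t.image Subtype.val, le_antisymm ?_ ?_⟩
  · rw [Finset.sup_image]
    exact Finset.sup_le fun i _ => (le_iSup (fun i : J => B i) i).trans hJ.ge
  · rw [Finset.sup_image, Finset.sup_eq_iSup]
    exact ht

lemma IsSpectralFrame.isCompactlyGenerated (hL : IsSpectralFrame.{w} L) :
    IsCompactlyGenerated L := by
  obtain ⟨I, B, hB, hc, -, -⟩ := hL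
  refine ⟨fun U => ?_⟩
  obtain ⟨J, rfl⟩ := hB U
  exact ⟨B '' J, by rintro _ ⟨i, _, rfl⟩; exact hc i, sSup_image⟩

lemma IsSpectralFrame.isCompactElement_top (hL : IsSpectralFrame.{w} L) :
    IsCompactElement (⊤ : L) := by
  obtain ⟨I, B, -, hc, ⟨t, ht⟩, -⟩ := hL
  exact ht ▸ hc t

lemma IsSpectralFrame.isCompactElement_inf (hL : IsSpectralFrame.{w} L) {a b : L}
    (ha : IsCompactElement a) (hb : IsCompactElement b) : IsCompactElement (a ⊓ b) := by
  obtain ⟨I, B, hB, hc, -, hinf⟩ := hL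
  obtain ⟨s, rfl⟩ := hB.exists_finset_sup_eq ha
  obtain ⟨t, rfl⟩ := hB.exists_finset_sup_eq hb
  rw [Finset.sup_inf_sup]
  refine CompleteLattice.isCompactElement_finsetSup _ fun p _ => ?_
  obtain ⟨k, hk⟩ := hinf p.1 p.2
  exact hk ▸ hc k

end Spectral

/-! ### The patch of a spectral frame -/

namespace PatchFrame

variable {L : Type v} [Order.Frame L]

lemma monotone_apply (V : L) : Monotone fun j : PatchFrame L => j.1 V := fun _ _ h => h V

/-- The pointwise join of a directed family of Scott continuous nuclei. -/
def directedSup (D : Set (PatchFrame L)) (hn : D.Nonempty) (hd : DirectedOn (· ≤ ·) D) :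
    Nucleus L where
  toFun V := ⨆ j ∈ D, j.1 V
  map_inf' U V := by
    refine le_antisymm (le_inf (iSup₂_mono fun j _ => j.1.monotone inf_le_left)
      (iSup₂_mono fun j _ => j.1.monotone inf_le_right)) ?_
    simp only [iSup_inf_eq, inf_iSup_eq]
    refine iSup₂_le fun j hj => iSup₂_le fun k hk => ?_
    obtain ⟨l, hl, h₁, h₂⟩ := hd j hj k hk
    refine le_trans ?_ (le_iSup₂ (f := fun (l : PatchFrame L) (_ : l ∈ D) => l.1 (U ⊓ V)) l hl)
    rw [Nucleus.map_inf]
    exact inf_le_inf (h₂ _) (h₁ _)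
  idempotent' V := by
    refine iSup₂_le fun j hj => ?_
    have hd' : DirectedOn (· ≤ ·) ((fun k : PatchFrame L => k.1 V) '' D) :=
      hd.mono_comp fun _ _ h => h V
    -- Scott continuity of `j` moves it inside the directed join; a common bound `l` of `j` and `k`
    -- then absorbs `j ∘ k`.
    rw [← sSup_image, j.2.apply_sSup (hn.image _) hd', iSup_image]
    refine iSup₂_le fun k hk => ?_
    obtain ⟨l, hl, h₁, h₂⟩ := hd j hj k hk
    refine le_trans ?_ (le_sSup ⟨l, hl, rfl⟩)
    exact ((h₁ _).trans (l.1.monotone (h₂ V))).trans (l.1.idempotent V).le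
  le_apply' V := by
    obtain ⟨j, hj⟩ := hn
    exact Nucleus.le_apply.trans
      (le_iSup₂ (f := fun (l : PatchFrame L) (_ : l ∈ D) => l.1 V) j hj)

/-- Joins in the patch are computed among all nuclei, so it suffices that the pointwise join is a
nucleus. -/
lemma sSup_apply_of_directedOn {D : Set (PatchFrame L)} (hn : D.Nonempty)
    (hd : DirectedOn (· ≤ ·) D) (V : L) : (sSup D).1 V = ⨆ j ∈ D, j.1 V := by
  refine le_antisymm ?_ (iSup₂_le fun j hj => monotone_apply V (le_sSup hj))
  have h : (sSup D).1 ≤ directedSup D hn hd := sSup_le (by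
    rintro _ ⟨j, hj, rfl⟩ U
    exact le_iSup₂ (f := fun (l : PatchFrame L) (_ : l ∈ D) => l.1 U) j hj)
  exact h V

lemma scottContinuous_apply (V : L) : ScottContinuous fun j : PatchFrame L => j.1 V :=
  (monotone_apply V).scottContinuous fun _ hn hd => (sSup_apply_of_directedOn hn hd V).le

lemma closed_le_iff {U : L} {j : PatchFrame L} : closed U ≤ j ↔ U ≤ j.1 ⊥ :=
  ⟨fun h => le_sup_left.trans (h ⊥),
    fun h _ => sup_le (h.trans (j.1.monotone bot_le)) Nucleus.le_apply⟩

/-- A nucleus is `⊤` as soon as its value at `⊥` is, and evaluation at `⊥` preserves directed joins.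
-/
lemma isCompactElement_top (hL : IsCompactElement (⊤ : L)) :
    IsCompactElement (⊤ : PatchFrame L) := by
  rw [CompleteLattice.isCompactElement_iff_le_of_directed_sSup_le]
  intro D hn hd hle
  obtain ⟨j, hj, h⟩ := hL.exists_le_of_le_biSup (monotone_apply ⊥) hn hd
    ((monotone_apply ⊥ hle).trans (sSup_apply_of_directedOn hn hd ⊥).le)
  exact ⟨j, hj, fun V => le_top.trans (h.trans (j.1.monotone bot_le))⟩

/-- The open nucleus `V ↦ (U ⇨ V)`. -/
def openNucleus (U : L) : Nucleus L where
  toFun V := U ⇨ V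
  map_inf' _ _ := himp_inf_distrib _ _ _
  idempotent' _ := himp_idem.le
  le_apply' _ := le_himp

/-- A compact `c` lies below `K ⇨ ⋁ d` iff `c ⊓ K ≤ ⋁ d`, and `c ⊓ K` is again compact. -/
lemma scottContinuous_openNucleus (hL : IsSpectralFrame.{w} L) {K : L} (hK : IsCompactElement K) :
    ScottContinuous (openNucleus K) := by
  have := hL.isCompactlyGenerated
  refine (openNucleus K).monotone.scottContinuous fun d hn hd => ?_
  rw [le_iff_compact_le_imp]
  intro c hc hle
  obtain ⟨x, hx, h⟩ := (CompleteLattice.isCompactElement_iff_le_of_directed_sSup_le L _).1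
    (hL.isCompactElement_inf hc hK) d hn hd (le_himp_iff.1 hle)
  exact (le_himp_iff.2 h).trans (le_iSup₂ (f := fun x (_ : x ∈ d) => openNucleus K x) x hx)

lemma isCompl_closed_of_openNucleus {K : L} (h : ScottContinuous (openNucleus K)) :
    IsCompl (closed K) (⟨openNucleus K, h⟩ : PatchFrame L) := by
  refine ⟨disjoint_iff_inf_le.2 fun V => ?_, codisjoint_iff_le_sup.2 fun V => ?_⟩
  · have : (K ⊔ V) ⊓ (K ⇨ V) ≤ V := by
      rw [inf_sup_right]
      exact sup_le inf_himp_le inf_le_left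
    exact this.trans Nucleus.le_apply
  · let o : PatchFrame L := ⟨openNucleus K, h⟩
    let s : PatchFrame L := closed K ⊔ o
    have h₁ : closed K ≤ s := le_sup_left
    have h₂ : o ≤ s := le_sup_right
    have h₃ : ⊤ ≤ s.1 (K ⊔ V) := le_trans (le_himp_iff.2 (by simp)) (h₂ (K ⊔ V))
    exact h₃.trans ((s.1.monotone (h₁ V)).trans (s.1.idempotent V).le)

/-- The open nucleus of a compact open, as the complement of the closed nucleus. -/
lemma exists_isCompl_closed (hL : IsSpectralFrame.{w} L) {K : L} (hK : IsCompactElement K) :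
    ∃ o : PatchFrame L, IsCompl (closed K) o ∧ ∀ V, o.1 V = K ⇨ V :=
  ⟨⟨openNucleus K, scottContinuous_openNucleus hL hK⟩, isCompl_closed_of_openNucleus _,
    fun _ => rfl⟩

lemma compl_closed_apply (hL : IsSpectralFrame.{w} L) {K : L} (hK : IsCompactElement K) (V : L) :
    (closed K)ᶜ.1 V = K ⇨ V := by
  obtain ⟨o, ho, h⟩ := exists_isCompl_closed hL hK
  rw [ho.compl_eq, h]

lemma isComplemented_closed (hL : IsSpectralFrame.{w} L) {K : L} (hK : IsCompactElement K) :
    IsComplemented (closed K) :=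
  let ⟨o, ho, _⟩ := exists_isCompl_closed hL hK
  ⟨o, ho⟩

/-- Together with `le_closed_inf_compl_closed_apply`, this makes `closed U ⊓ (closed K)ᶜ` the least
`j` with `U ≤ j K`. -/
lemma closed_inf_compl_closed_le (hL : IsSpectralFrame.{w} L) {K U : L} (hK : IsCompactElement K)
    {j : PatchFrame L} (h : U ≤ j.1 K) : closed U ⊓ (closed K)ᶜ ≤ j := by
  intro V
  have key : (U ⊔ V) ⊓ (closed K)ᶜ.1 V ≤ j.1 V := by
    rw [compl_closed_apply hL hK, inf_sup_right]
    refine sup_le ?_ (inf_le_left.trans Nucleus.le_apply)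
    calc U ⊓ (K ⇨ V) ≤ j.1 K ⊓ j.1 (K ⇨ V) := inf_le_inf h Nucleus.le_apply
      _ = j.1 (K ⊓ (K ⇨ V)) := Nucleus.map_inf.symm
      _ ≤ j.1 V := j.1.monotone inf_himp_le
  exact key

lemma le_closed_inf_compl_closed_apply (hL : IsSpectralFrame.{w} L) {K : L}
    (hK : IsCompactElement K) (U : L) : U ≤ (closed U ⊓ (closed K)ᶜ).1 K := by
  have key : U ≤ (U ⊔ K) ⊓ (closed K)ᶜ.1 K := by
    rw [compl_closed_apply hL hK, himp_self, inf_top_eq]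
    exact le_sup_left
  exact key

lemma le_of_forall_isCompactElement (hL : IsSpectralFrame.{w} L) {j k : PatchFrame L}
    (h : ∀ K, IsCompactElement K → j.1 K ≤ k.1 K) : j ≤ k :=
  have := hL.isCompactlyGenerated
  fun V => j.2.le_of_forall_isCompactElement k.1.monotone h V

lemma eq_biSup_closed_inf_compl_closed (hL : IsSpectralFrame.{w} L) (j : PatchFrame L) :
    j = ⨆ K ∈ {K : L | IsCompactElement K}, closed (j.1 K) ⊓ (closed K)ᶜ := by
  refine le_antisymm (le_of_forall_isCompactElement hL fun K hK => ?_)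
    (iSup₂_le fun K hK => closed_inf_compl_closed_le hL hK le_rfl)
  exact (le_closed_inf_compl_closed_apply hL hK _).trans (monotone_apply K
    (le_iSup₂ (f := fun K (_ : K ∈ {K : L | IsCompactElement K}) =>
      closed (j.1 K) ⊓ (closed K)ᶜ) K hK))

/-- In the join formula `j K` need not be compact, so `closed (j K)` need not be clopen. Splitting
`j K` into basic opens, and writing `K` as a finite join of them, yields clopens with a small index.
-/
lemma isZeroDimensionalFrame (hL : IsSpectralFrame.{w} L) :
    IsZeroDimensionalFrame.{w} (PatchFrame L) := by
  obtain ⟨I, B, hB, hc, -⟩ := id hL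
  have hsup (t : Finset I) : IsCompactElement (t.sup B) :=
    CompleteLattice.isCompactElement_finsetSup t fun i _ => hc i
  let C : I × Finset I → PatchFrame L := fun p => closed (B p.1) ⊓ (closed (p.2.sup B))ᶜ
  refine ⟨I × Finset I, C, fun j => ?_, fun p => ?_⟩
  · refine ⟨{p | B p.1 ≤ j.1 (p.2.sup B)},
      le_antisymm (le_of_forall_isCompactElement hL fun K hK => ?_)
        (iSup₂_le fun p hp => closed_inf_compl_closed_le hL (hsup _) hp)⟩
    obtain ⟨t, rfl⟩ := hB.exists_finset_sup_eq hK
    obtain ⟨J, hJ⟩ := hB (j.1 (t.sup B))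
    have hJ' (i : I) (hi : i ∈ J) : B i ≤ j.1 (t.sup B) :=
      hJ ▸ le_iSup₂ (f := fun i (_ : i ∈ J) => B i) i hi
    conv_lhs => rw [hJ]
    refine iSup₂_le fun i hi => ?_
    exact (le_closed_inf_compl_closed_apply hL hK _).trans (monotone_apply _
      (le_iSup₂ (f := fun p (_ : p ∈ {p : I × Finset I | B p.1 ≤ j.1 (p.2.sup B)}) => C p)
        (i, t) (hJ' i hi)))
  · obtain ⟨o, ho, -⟩ := exists_isCompl_closed hL (hsup p.2)
    refine isClopenElement_iff.2 ((isComplemented_closed hL (hc p.1)).inf ?_)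
    rw [ho.compl_eq]
    exact ⟨_, ho.symm⟩

lemma isStoneFrame (hL : IsSpectralFrame.{w} L) : IsStoneFrame.{w} (PatchFrame L) :=
  ⟨isCompactElement_top hL.isCompactElement_top, isZeroDimensionalFrame hL⟩

end PatchFrame

/-! ### Perfect maps and spectral maps -/

namespace Locale

variable {X Y : Locale.{v}}

lemma hom_ext_of_invImage {f g : X ⟶ Y} (h : ∀ U, invImage f U = invImage g U) : f = g :=
  Quiver.Hom.unop_inj (Frm.ext h)

lemma gc_invImage_directImage (f : X ⟶ Y) : GaloisConnection (invImage f) (directImage f) := by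
  intro V U
  refine ⟨fun h => le_sSup h, fun h => (OrderHomClass.mono (invImage f) h).trans ?_⟩
  rw [directImage, map_sSup]
  exact sSup_le (by rintro _ ⟨W, hW, rfl⟩; exact hW)

lemma IsPerfectMap.isSpectralMap {f : X ⟶ Y} (hf : IsPerfectMap f) : IsSpectralMap f := by
  intro V hV
  rw [CompleteLattice.isCompactElement_iff_le_of_directed_sSup_le]
  intro d hn hd hle
  have gc := gc_invImage_directImage f
  rw [gc.le_iff_le, hf.apply_sSup hn hd] at hle
  obtain ⟨x, hx, h⟩ := hV.exists_le_of_le_biSup gc.monotone_u hn hd hle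
  exact ⟨x, hx, gc.l_le h⟩

/-- Compact `c` generate `Y`, and `c ≤ f_*(⋁ d)` transposes to `f^* c ≤ ⋁ d` with `f^* c` compact.
-/
lemma IsSpectralMap.isPerfectMap (hY : IsSpectral.{w} Y) {f : X ⟶ Y} (hf : IsSpectralMap f) :
    IsPerfectMap f := by
  have := IsSpectralFrame.isCompactlyGenerated hY
  have gc := gc_invImage_directImage f
  refine gc.monotone_u.scottContinuous fun d hn hd => ?_
  rw [le_iff_compact_le_imp]
  intro c hc hle
  obtain ⟨x, hx, h⟩ := (CompleteLattice.isCompactElement_iff_le_of_directed_sSup_le X _).1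
    (hf c hc) d hn hd (gc.l_le hle)
  exact (gc.le_u h).trans (le_iSup₂ (f := fun x (_ : x ∈ d) => directImage f x) x hx)

lemma IsSpectral.isStone_patch {A : Locale.{v}} (hA : IsSpectral.{w} A) : IsStone.{w} (patch A) :=
  PatchFrame.isStoneFrame hA

lemma directImage_patchCounit (A : Locale.{v}) (j : PatchFrame A) :
    directImage (patchCounit A) j = j.1 ⊥ :=
  eq_of_forall_le_iff fun U =>
    ((gc_invImage_directImage (patchCounit A)).le_iff_le (a := U) (b := j)).symm.trans
      PatchFrame.closed_le_iff

lemma isPerfectMap_patchCounit (A : Locale.{v}) : IsPerfectMap (patchCounit A) := by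
  have h : directImage (patchCounit A) = fun j : PatchFrame A => j.1 ⊥ :=
    funext (directImage_patchCounit A)
  rw [IsPerfectMap, h]
  exact PatchFrame.scottContinuous_apply ⊥

end Locale

/-! ### The universal property of the patch -/

namespace PatchFrame

variable {L M : Type v} [Order.Frame L] [Order.Frame M]

/-- Frame homomorphisms preserve complements, so the join formula determines them from closed
nuclei. -/
lemma frameHom_ext (hL : IsSpectralFrame.{w} L) {g h : FrameHom (PatchFrame L) M}
    (H : ∀ U, g (closed U) = h (closed U)) : g = h := by
  have hc {K : L} (hK : IsCompactElement K) : g (closed K)ᶜ = h (closed K)ᶜ := by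
    obtain ⟨o, ho, -⟩ := exists_isCompl_closed hL hK
    have hg := ho.map g
    have hh := ho.map h
    rw [ho.compl_eq, ← hg.compl_eq, ← hh.compl_eq, H]
  ext j
  rw [eq_biSup_closed_inf_compl_closed hL j]
  simp only [map_iSup, map_inf, H]
  exact iSup_congr fun K => iSup_congr fun hK => by rw [hc hK]

/-- The Scott continuous nucleus `V ↦ f_* (f^* V ⊔ W)`. -/
def pushforward (f : FrameHom L M) (r : M → L) (gc : GaloisConnection f r)
    (hr : ScottContinuous r) (W : M) : PatchFrame L where
  val :=
    { toFun V := r (f V ⊔ W)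
      map_inf' U V := by rw [map_inf, sup_inf_right, gc.u_inf]
      idempotent' V := gc.monotone_u (sup_le (gc.l_u_le _) le_sup_right)
      le_apply' V := gc.le_u le_sup_left }
  property := by
    refine Monotone.scottContinuous (fun U V h => gc.monotone_u
      (sup_le_sup_right (OrderHomClass.mono f h) W)) fun d hn hd => ?_
    have hm : Monotone fun V => f V ⊔ W := fun U V h =>
      sup_le_sup_right (OrderHomClass.mono f h) W
    have h : f (sSup d) ⊔ W ≤ sSup ((fun V => f V ⊔ W) '' d) := by
      obtain ⟨x, hx⟩ := hn
      rw [map_sSup]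
      refine sup_le (sSup_le ?_) (le_sup_right.trans (le_sSup ⟨x, hx, rfl⟩))
      rintro _ ⟨y, hy, rfl⟩
      exact le_sup_left.trans (le_sSup ⟨y, hy, rfl⟩)
    refine (gc.monotone_u h).trans ?_
    rw [hr.apply_sSup (hn.image _) (hd.mono_comp fun _ _ h => hm h), iSup_image]
    rfl

lemma pushforward_apply (f : FrameHom L M) (r : M → L) (gc : GaloisConnection f r)
    (hr : ScottContinuous r) (W : M) (V : L) :
    (pushforward f r gc hr W).1 V = r (f V ⊔ W) := rfl

/-- The extension of `f` to the patch: `j ↦ ⋁ f (j K) ⊓ (f K)ᶜ` over the compact opens `K`. -/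
def extend (f : L → M) (j : PatchFrame L) : M :=
  ⨆ K ∈ {K : L | IsCompactElement K}, f (j.1 K) ⊓ (f K)ᶜ

lemma le_extend (f : L → M) (j : PatchFrame L) {K : L} (hK : IsCompactElement K) :
    f (j.1 K) ⊓ (f K)ᶜ ≤ extend f j :=
  le_iSup₂ (f := fun K (_ : K ∈ {K : L | IsCompactElement K}) => f (j.1 K) ⊓ (f K)ᶜ) K hK

lemma gc_extend_pushforward (hL : IsSpectralFrame.{w} L) (f : FrameHom L M)
    (hf : ∀ K, IsCompactElement K → IsComplemented (f K)) (r : M → L)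
    (gc : GaloisConnection f r) (hr : ScottContinuous r) :
    GaloisConnection (extend f) (pushforward f r gc hr) := by
  intro j W
  have key (K : L) (hK : IsCompactElement K) :
      f (j.1 K) ⊓ (f K)ᶜ ≤ W ↔ j.1 K ≤ (pushforward f r gc hr W).1 K := by
    -- Since `f K` is complemented, its complement moves across the inequality: `f (j K) ≤ f K ⊔ W`.
    obtain ⟨c, hc⟩ := hf K hK
    rw [pushforward_apply, ← gc.le_iff_le, hc.compl_eq, sup_comm,
      hc.symm.le_sup_right_iff_inf_left_le]
  constructor
  · exact fun h => le_of_forall_isCompactElement hL fun K hK =>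
      (key K hK).1 ((le_extend f j hK).trans h)
  · exact fun h => iSup₂_le fun K hK => (key K hK).2 (h K)

/-- The extension of `f` to the patch as a frame homomorphism. -/
def extendHom (hL : IsSpectralFrame.{w} L) (f : FrameHom L M)
    (hf : ∀ K, IsCompactElement K → IsComplemented (f K)) (r : M → L)
    (gc : GaloisConnection f r) (hr : ScottContinuous r) : FrameHom (PatchFrame L) M where
  toFun := extend f
  map_inf' j k := by
    refine le_antisymm ((gc_extend_pushforward hL f hf r gc hr).monotone_l.map_inf_le j k) ?_
    simp only [extend, iSup_inf_eq, inf_iSup_eq]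
    refine iSup₂_le fun K hK => iSup₂_le fun K' hK' => ?_
    -- The index `K ⊔ K'` works for both terms: `j` and `k` only grow there, and its complement is
    -- the meet of the two complements.
    refine le_trans ?_ (le_extend f (j ⊓ k) (isCompactElement_sup hK hK'))
    have h : (j ⊓ k).1 (K ⊔ K') = j.1 (K ⊔ K') ⊓ k.1 (K ⊔ K') := rfl
    have hm := OrderHomClass.mono f
    rw [h, InfHomClass.map_inf f, SupHomClass.map_sup f, compl_sup, inf_comm (f K)ᶜ]
    exact (inf_inf_inf_comm _ _ _ _).le.trans (inf_le_inf_right _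
      (inf_le_inf (hm (j.1.monotone le_sup_right)) (hm (k.1.monotone le_sup_left))))
  map_top' := by
    refine top_le_iff.1 (le_trans ?_ (le_extend f ⊤ isCompactElement_bot))
    have h : (⊤ : PatchFrame L).1 ⊥ = ⊤ := rfl
    simp [h]
  map_sSup' S := by
    rw [(gc_extend_pushforward hL f hf r gc hr).l_sSup, sSup_image]

/-- The term at `K` is `f U ⊓ (f K)ᶜ`, which is largest at `K = ⊥`. -/
lemma extend_closed (f : FrameHom L M) (U : L) : extend f (closed U) = f U := by
  refine le_antisymm (iSup₂_le fun K _ => ?_) (le_trans ?_ (le_extend f _ isCompactElement_bot))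
  · have h : (closed U).1 K = U ⊔ K := rfl
    rw [h, map_sup, inf_sup_right, inf_compl_self, sup_bot_eq]
    exact inf_le_left
  · have h : (closed U).1 ⊥ = U ⊔ ⊥ := rfl
    simp [h]

end PatchFrame

namespace Locale

lemma existsUnique_comp_patchCounit {X A : Locale.{v}} (hX : IsStone.{w} X)
    (hA : IsSpectral.{w} A) (f : X ⟶ A) (hf : IsSpectralMap f) :
    ∃! g : X ⟶ patch A, IsSpectralMap g ∧ g ≫ patchCounit A = f := by
  have hc (K : A) (hK : IsCompactElement K) : IsComplemented (invImage f K) :=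
    isClopenElement_iff.1 ((hf K hK).isClopenElement hX.2)
  let h : FrameHom (PatchFrame A) X := PatchFrame.extendHom hA (invImage f) hc (directImage f)
    (gc_invImage_directImage f) (hf.isPerfectMap hA)
  refine ⟨ofInvImage (Y := patch A) h, ⟨hX.isSpectralMap hA.isStone_patch _,
    hom_ext_of_invImage fun U => PatchFrame.extend_closed (invImage f) U⟩, ?_⟩
  rintro g ⟨-, hg⟩
  have : invImage g = h := PatchFrame.frameHom_ext (L := A) hA fun U => by
    refine Eq.trans ?_ (PatchFrame.extend_closed (invImage f) U).symm
    rw [← hg]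
    rfl
  exact hom_ext_of_invImage fun U => DFunLike.congr_fun this U

end Locale

/-! ### The coreflection -/

instance : stoneToSpec.{w, v}.Full where
  map_surjective f := ⟨ObjectProperty.homMk f.map, rfl⟩

instance : stoneToSpec.{w, v}.Faithful where
  map_injective h := ObjectProperty.hom_ext _ (congrArg SpecLocale.Hom.map h)

/-- The patch of a spectral locale as an object of the category of Stone locales. -/
def SpecLocale.patch (A : SpecLocale.{w, v}) : StoneLocale.{w, v} :=
  ⟨A.carrier.patch, A.isSpectral.isStone_patch⟩

/-- The counit, as a morphism of spectral locales. -/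
def SpecLocale.patchCounit (A : SpecLocale.{w, v}) : stoneToSpec.obj A.patch ⟶ A :=
  ⟨A.carrier.patchCounit, (Locale.isPerfectMap_patchCounit _).isSpectralMap⟩

lemma SpecLocale.bijective_comp_patchCounit (X : StoneLocale.{w, v}) (A : SpecLocale.{w, v}) :
    Function.Bijective fun g : X ⟶ A.patch => stoneToSpec.map g ≫ A.patchCounit := by
  rw [Function.bijective_iff_existsUnique]
  intro f
  obtain ⟨g, ⟨-, hg⟩, huniq⟩ :=
    Locale.existsUnique_comp_patchCounit X.property A.isSpectral f.map f.isSpectralMap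
  refine ⟨ObjectProperty.homMk g, SpecLocale.Hom.ext hg, fun g' hg' => ?_⟩
  exact ObjectProperty.hom_ext _ (huniq g'.hom
    ⟨X.property.isSpectralMap A.patch.property _, congrArg SpecLocale.Hom.map hg'⟩)

/-- Maps from a Stone locale to a spectral locale are maps to its patch. -/
noncomputable def SpecLocale.patchHomEquiv (X : StoneLocale.{w, v}) (A : SpecLocale.{w, v}) :
    (stoneToSpec.obj X ⟶ A) ≃ (X ⟶ A.patch) :=
  (Equiv.ofBijective _ (SpecLocale.bijective_comp_patchCounit X A)).symm

lemma SpecLocale.patchHomEquiv_symm_apply {X : StoneLocale.{w, v}} {A : SpecLocale.{w, v}}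
    (g : X ⟶ A.patch) :
    (SpecLocale.patchHomEquiv X A).symm g = stoneToSpec.map g ≫ A.patchCounit := rfl

lemma SpecLocale.patchHomEquiv_naturality (X' X : StoneLocale.{w, v}) (A : SpecLocale.{w, v})
    (f : X' ⟶ X) (g : stoneToSpec.obj X ⟶ A) :
    SpecLocale.patchHomEquiv X' A (stoneToSpec.map f ≫ g) =
      f ≫ SpecLocale.patchHomEquiv X A g := by
  rw [← Equiv.eq_symm_apply, SpecLocale.patchHomEquiv_symm_apply, Functor.map_comp,
    Category.assoc, ← SpecLocale.patchHomEquiv_symm_apply, Equiv.symm_apply_apply]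

/-- Stone locales are coreflective in spectral locales, with coreflector the patch. -/
@[reducible]
noncomputable def stoneToSpecCoreflective : Coreflective stoneToSpec.{w, v} where
  R := _
  adj := Adjunction.adjunctionOfEquivRight SpecLocale.patchHomEquiv
    SpecLocale.patchHomEquiv_naturality

lemma stoneToSpecCoreflective_counit (A : SpecLocale.{w, v}) :
    stoneToSpecCoreflective.adj.counit.app A = A.patchCounit := by
  refine (Adjunction.adjunctionOfEquivRight_counit_app _ _ A).trans ?_
  rw [SpecLocale.patchHomEquiv_symm_apply]
  exact (congrArg (· ≫ A.patchCounit) (stoneToSpec.map_id A.patch)).trans (Category.id_comp _)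

theorem mainTheorem1 :
    -- the patch of a spectral locale is Stone
    ∃ hpatch : ∀ A : Locale.{v}, Locale.IsSpectral.{w} A → Locale.IsStone.{w} (Locale.patch A),
      -- perfect maps and spectral maps between spectral locales are the same
      (∀ X Y : Locale.{v}, Locale.IsSpectral.{w} X → Locale.IsSpectral.{w} Y →
        ∀ f : X ⟶ Y, Locale.IsPerfectMap f ↔ Locale.IsSpectralMap f) ∧
      -- the counit is perfect
      (∀ A : Locale.{v}, Locale.IsSpectral.{w} A → Locale.IsPerfectMap (Locale.patchCounit A)) ∧
      -- the universal property
      (∀ X A : Locale.{v}, Locale.IsStone.{w} X → Locale.IsSpectral.{w} A →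
        ∀ f : X ⟶ A, Locale.IsSpectralMap f →
          ∃! g : X ⟶ Locale.patch A, Locale.IsSpectralMap g ∧ g ≫ Locale.patchCounit A = f) ∧
      -- the inclusion is coreflective, with right adjoint given by the patch and counit by `ε`
      ∃ (c : Coreflective stoneToSpec.{w, v})
        (hobj : ∀ A : SpecLocale.{w, v}, c.R.obj A = ⟨A.carrier.patch, hpatch _ A.isSpectral⟩),
        ∀ A : SpecLocale.{w, v},
          (c.adj.counit.app A).map = (eqToHom (hobj A)).hom ≫ A.carrier.patchCounit := by
  refine ⟨fun A hA => hA.isStone_patch,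
    fun X Y _ hY f => ⟨fun hf => hf.isSpectralMap, fun hf => hf.isPerfectMap hY⟩,
    fun A _ => Locale.isPerfectMap_patchCounit A,
    fun X A hX hA f hf => Locale.existsUnique_comp_patchCounit hX hA f hf,
    stoneToSpecCoreflective, fun _ => rfl, fun A => ?_⟩
  rw [stoneToSpecCoreflective_counit]
  -- The object equality is `rfl`, so its `eqToHom` is the identity.
  exact (Category.id_comp _).symm
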